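/- \textbf{Theorem (Long-term influence bound).} Let $(\mathcal{X},\rho)$ be a bounded separable metric space and let $\nu$ be a finite Borel measure on it that is \emph{upper doubling}: there are $d>0$ and $c>0$ such that, for all $x \in \mathcal{X}$ and $r>0$, the open ball $B(x,r)$ is covered by at most $2^d$ closed balls of radius $r/2$, and $\nu(B(x,r)) \le c\,r^d$. Then there are constants $c_1,c_2>0$, depending only on $(\mathcal{X},\rho,\nu)$, such that the following holds. Let $\mathbb{X}=(X_n)_{n\ge 0}$ be a stochastic process in $\mathcal{X}$ that is \emph{uniformly dominated by $\nu$ at rate $\epsilon(\cdot)$}: $\epsilon(\delta)\to 0$ as $\delta \downarrow 0$, and for every $\delta>0$ and every measurable $A\subset\mathcal{X}$ with $\nu(A)<\delta$, \[\sup_{n\ge 0}\,\Pr\big(X_n\in A \,\big|\, X_0,\dots,X_{n-1}\big)<\epsilon(\delta)\qquad\text{a.s.}\] Let $(\tilde X_n)_{n\ge 1}$ be any nearest neighbor process of $\mathbb{X}$, that is, $\tilde X_n\in\operatorname{arg\,min}_{x\in\{X_0,\dots,X_{n-1}\}}\rho(X_n,x)$ for all $n \ge 1$, with ties broken arbitrarily.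 Let $(I_n)_{n\ge 0}$ be a $\{0,1\}$-valued process adapted to $\mathbb{X}$ (each $I_n$ is $\sigma(X_0,\dots,X_n)$-measurable) that is \emph{asymptotically rate-limited by $\gamma>0$}: almost surely $\limsup_{n\to\infty}\frac1n\sum_{m=0}^n I_m<\gamma$. Then for every $\delta>0$, \[\limsup_{N\to\infty}\,\frac1N\sum_{n=1}^N \mathbf 1\big\{\tilde X_n\in\{X_m: m<n,\ I_m=1\}\big\}\;<\;\gamma\cdot\max\Big\{0,\;c_1+c_2\log\frac1\delta\Big\}+\epsilon(\delta)\qquad\text{a.s.}\] -/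

import Mathlib

open MeasureTheory ProbabilityTheory Filter Topology

universe u v

noncomputable section

namespace NNInfluence

/-- Every open ball of radius `r` is covered by at most `2 ^ d` balls of radius `r / 2`. The
covering balls are taken closed: this is implied by a covering with open balls, and it is what makes
`ℝ` (where an open interval is not covered by two open intervals of half its length) doubling with
`d = 1`, so that the Lebesgue measure is upper doubling. -/
def IsDoubling (S : Type*) [PseudoMetricSpace S] (d : ℝ) : Prop :=
  ∀ (x : S) (r : ℝ), 0 < r →
    ∃ t : Finset S, (t.card : ℝ) ≤ (2 : ℝ) ^ d ∧
      Metric.ball x r ⊆ ⋃ y ∈ t, Metric.closedBall y (r / 2)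

/-- The space is doubling with some dimension `d > 0`, and the mass of every ball of radius `r`
is at most `c * r ^ d`, with the same `d`. -/
def IsUpperDoubling {S : Type*} [PseudoMetricSpace S] [MeasurableSpace S]
    (ν : Measure S) : Prop :=
  ∃ d : ℝ, 0 < d ∧ IsDoubling S d ∧
    ∃ c : ℝ, 0 < c ∧ ∀ (x : S) (r : ℝ), 0 < r →
      ν (Metric.ball x r) ≤ ENNReal.ofReal (c * r ^ d)

/-- The σ-algebra generated by the instances `X m` with `m < n`. -/
@[reducible] def past {Ω S : Type*} [MeasurableSpace S] (X : ℕ → Ω → S) (n : ℕ) : MeasurableSpace Ω :=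
  ⨆ m : ℕ, ⨆ _ : m < n, MeasurableSpace.comap (X m) inferInstance

/-- `X` is uniformly dominated by `ν` at rate `ε`: the rate `ε δ` tends to `0` as `δ` decreases
to `0`, and any measurable set of mass less than `δ` has, almost surely, conditional probability
given the past less than `ε δ`, uniformly in time. -/
def UniformlyDominated {Ω S : Type*} [MeasurableSpace Ω] [MeasurableSpace S]
    (P : Measure Ω) (ν : Measure S) (X : ℕ → Ω → S) (ε : ℝ → ℝ) : Prop :=
  Tendsto ε (𝓝[>] 0) (𝓝 0) ∧
    ∀ δ : ℝ, 0 < δ → ∀ A : Set S, MeasurableSet A → ν A < ENNReal.ofReal δ →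
      ∀ᵐ ω ∂P, ⨆ n : ℕ, (P⟦X n ⁻¹' A | past X n⟧) ω < ε δ

/-- A nearest neighbor process: for every `n ≥ 1`, `Xt n` minimizes the distance to `X n` over
the earlier instances, ties being broken arbitrarily. -/
def IsNearestNeighborProcess {Ω S : Type*} [PseudoMetricSpace S] (X Xt : ℕ → Ω → S) : Prop :=
  ∀ n : ℕ, 1 ≤ n → ∀ ω : Ω,
    (∃ m : ℕ, m < n ∧ Xt n ω = X m ω) ∧
      ∀ m : ℕ, m < n → dist (X n ω) (Xt n ω) ≤ dist (X n ω) (X m ω)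

/-- The indicator process `I` is adapted to `X`: `I n` is a function of `X 0, …, X n`. -/
def IsAdaptedTo {Ω S : Type*} [MeasurableSpace S] (I : ℕ → Ω → Bool) (X : ℕ → Ω → S) : Prop :=
  ∀ n : ℕ, Measurable[past X (n + 1)] (I n)

/-- The number of indications given by time `n` (inclusive). -/
def counter {Ω : Type*} (I : ℕ → Ω → Bool) (n : ℕ) (ω : Ω) : ℕ :=
  ∑ m ∈ Finset.range (n + 1), (I m ω).toNat

/-- Almost surely, the asymptotic rate of indications is less than `γ`. -/
def IsRateLimited {Ω : Type*} [MeasurableSpace Ω] (P : Measure Ω) (I : ℕ → Ω → Bool)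
    (γ : ℝ) : Prop :=
  ∀ᵐ ω ∂P, limsup (fun n : ℕ => (counter I n ω : ℝ) / n) atTop < γ

/-- The set of instances indicated strictly before time `n`. -/
def indicated {Ω S : Type*} (X : ℕ → Ω → S) (I : ℕ → Ω → Bool) (n : ℕ) (ω : Ω) : Set S :=
  {x | ∃ m : ℕ, m < n ∧ I m ω = true ∧ X m ω = x}

/-- The fraction of times `n = 1, …, N` at which the chosen nearest neighbor `Xt n` is one of the
previously indicated instances. -/
def influenceRate {Ω S : Type*} (X Xt : ℕ → Ω → S) (I : ℕ → Ω → Bool) (N : ℕ) (ω : Ω) : ℝ :=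
  1 / (N : ℝ) *
    ∑ n ∈ Finset.Icc 1 N, {n : ℕ | Xt n ω ∈ indicated X I n ω}.indicator (fun _ => (1 : ℝ)) n

end NNInfluence

end

/-!
An indicated instance can be chosen as the nearest neighbor of `X n` either at a distance at least
`r n` or at a smaller one, where `r n ^ d` is a suitable multiple of `δ / (γ * n)`.

At large distances the bound is deterministic. The instances whose distance to their nearest
predecessor is about `2⁻ᵏ` are `2⁻ᵏ`-separated, up to constants. By packing, there are
`O(2 ^ (d * k))` of them in the bounded space, and `O(1)` of them that choose a given instance as
their nearest neighbor. With at most `γ * N` indicated instances, the number of influences up to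
time `N` at scale `k` is therefore `O(min (2 ^ (d * k)) (γ * N))`. The scales with
`2 ^ (d * k) ≤ γ * N` contribute `O(γ * N)` altogether, as a geometric series, and the relevant
scales above them, up to `2 ^ (d * k) ≈ γ * N / δ`, number `O(1 + log (1 / δ))`, independently of
`N` (`IsDoubling.card_far_influence_le`). It matters that the exponent `d` of the packing bound is
exactly the one in the mass bound of `ν`; otherwise the number of these scales would grow with `N`.

At small distances, `X n` falls into the union of the balls of radius `r n` around the indicated
instances, a random set that is determined by the past and whose `ν`-mass is less than `δ` by upper
doubling. Replacing the centers by nearby points of a countable dense set, only countably many such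
sets occur, so that domination by `ν` bounds the conditional probability of this event by `ε δ`
(`measure_inter_mem_le`). Chernoff's bound for adapted events and the Borel-Cantelli lemma show that
its asymptotic frequency is at most `ε δ` (`ae_eventually_sum_indicator_le`).

The inequality is strict because `c₁` is taken larger than the far estimate requires. When `δ`
exceeds the total mass of `ν`, the logarithmic term may be negative, but then `ε δ > 1`.
-/

open scoped ENNReal

namespace NNInfluence

/-! ### Packing in doubling spaces -/

/-- Iterated doubling without loss in the exponent: the factors `2 - 2⁻ʲ` increase with `j`, which
leaves room to replace the closed balls provided by `IsDoubling` by open balls at every step, while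
the radii stay below `2 * R * 2⁻ʲ`. -/
lemma IsDoubling.exists_cover {S : Type*} [PseudoMetricSpace S] {d : ℝ} (hd : IsDoubling S d)
    (x : S) {R : ℝ} (hR : 0 < R) (j : ℕ) :
    ∃ t : Finset S, (t.card : ℝ) ≤ ((2 : ℝ) ^ d) ^ j ∧
      Metric.ball x R ⊆ ⋃ y ∈ t, Metric.ball y (R * (2 - (1 / 2) ^ j) * (1 / 2) ^ j) := by
  classical
  induction j with
  | zero => exact ⟨{x}, by simp, by norm_num⟩
  | succ j ih =>
    obtain ⟨t, htc, ht⟩ := ih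
    have hpow : (0 : ℝ) < (1 / 2) ^ j := by positivity
    have hpow1 : ((1 : ℝ) / 2) ^ j ≤ 1 := pow_le_one₀ (by norm_num) (by norm_num)
    have hr : 0 < R * (2 - (1 / 2) ^ j) * (1 / 2) ^ j := by
      have : (0 : ℝ) < 2 - (1 / 2) ^ j := by linarith
      positivity
    choose f hfc hf using fun y : S => hd y _ hr
    refine ⟨t.biUnion f, ?_, fun a ha => ?_⟩
    · calc ((t.biUnion f).card : ℝ) ≤ ∑ y ∈ t, ((f y).card : ℝ) := by
            exact_mod_cast Finset.card_biUnion_le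
        _ ≤ ∑ _y ∈ t, (2 : ℝ) ^ d := Finset.sum_le_sum fun y _ => hfc y
        _ = t.card * (2 : ℝ) ^ d := by simp
        _ ≤ ((2 : ℝ) ^ d) ^ j * (2 : ℝ) ^ d := by gcongr
        _ = _ := (pow_succ _ _).symm
    · obtain ⟨y, hy, hay⟩ := Set.mem_iUnion₂.1 (ht ha)
      obtain ⟨z, hz, haz⟩ := Set.mem_iUnion₂.1 (hf y hay)
      refine Set.mem_iUnion₂.2 ⟨z, Finset.mem_biUnion.2 ⟨y, hy, hz⟩, ?_⟩
      refine Metric.closedBall_subset_ball ?_ haz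
      have h1 : 0 < R * (1 / 2) ^ j * (1 / 2) ^ j := by positivity
      rw [pow_succ]
      nlinarith

/-- Packing bound: a family of points in a ball of radius `R` at mutual distances at least
`4 * R * 2⁻ʲ` has at most `(2 ^ d) ^ j` members. -/
lemma IsDoubling.card_le_of_separated {S ι : Type*} [PseudoMetricSpace S] {d : ℝ}
    (hd : IsDoubling S d) (s : Finset ι) (x : ι → S) (z : S) {R : ℝ} (hR : 0 < R) (j : ℕ)
    (hx : ∀ n ∈ s, x n ∈ Metric.ball z R)
    (hsep : ∀ n ∈ s, ∀ m ∈ s, n ≠ m → 4 * R * (1 / 2) ^ j ≤ dist (x n) (x m)) :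
    (s.card : ℝ) ≤ ((2 : ℝ) ^ d) ^ j := by
  obtain ⟨t, htc, ht⟩ := hd.exists_cover z hR j
  refine le_trans ?_ htc
  have h : ∀ n ∈ s, ∃ y ∈ t, x n ∈ Metric.ball y (R * (2 - (1 / 2) ^ j) * (1 / 2) ^ j) :=
    fun n hn => by simpa using ht (hx n hn)
  have : Nonempty S := ⟨z⟩
  choose! f hft hf using h
  refine mod_cast Finset.card_le_card_of_injOn f hft fun n hn m hm hnm => ?_
  by_contra hne
  have h1 := Metric.mem_ball.1 (hf n hn)
  have h2 := Metric.mem_ball.1 (hf m hm)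
  rw [← hnm] at h2
  have h3 := dist_triangle_right (x n) (x m) (f n)
  have h4 : 0 < R * (1 / 2) ^ j * (1 / 2) ^ j := by positivity
  have h5 := hsep n hn m hm hne
  nlinarith

/-! ### Influence at large distance -/

/-- A geometric progression truncated at height `Γ`: the terms below `Γ` sum to `O(Γ)`, and if the
last one is at most `Γ * a ^ i`, then at most `i` of them exceed `Γ`. -/
lemma sum_min_pow_le {a Γ : ℝ} (ha : 1 < a) (hΓ : 0 < Γ) (i K : ℕ) (hK : a ^ K ≤ Γ * a ^ i) :
    ∑ k ∈ Finset.range (K + 1), min (a ^ k) Γ ≤ Γ * (i + a / (a - 1)) := by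
  have ha1 : 0 < a - 1 := by linarith
  induction i generalizing K with
  | zero =>
    calc ∑ k ∈ Finset.range (K + 1), min (a ^ k) Γ ≤ ∑ k ∈ Finset.range (K + 1), a ^ k :=
          Finset.sum_le_sum fun k _ => min_le_left _ _
      _ = (a ^ (K + 1) - 1) / (a - 1) := geom_sum_eq ha.ne' _
      _ ≤ Γ * a / (a - 1) := by
          gcongr
          rw [pow_succ]
          rw [pow_zero, mul_one] at hK
          nlinarith
      _ = _ := by simp [mul_div_assoc]
  | succ i ih =>
    have hnn : 0 ≤ Γ * (i + a / (a - 1)) := by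
      have : 0 < a / (a - 1) := by positivity
      positivity
    rw [Finset.sum_range_succ]
    have hlast : min (a ^ K) Γ ≤ Γ := min_le_right _ _
    have hrest : ∑ k ∈ Finset.range K, min (a ^ k) Γ ≤ Γ * (i + a / (a - 1)) := by
      cases K with
      | zero => simpa using hnn
      | succ K =>
        refine ih K (le_of_mul_le_mul_right ?_ (zero_lt_one.trans ha))
        rw [pow_succ, pow_succ] at hK
        linarith
    push_cast
    nlinarith

open Classical in
/-- The number of times up to `N` at which an indicated instance is the nearest neighbor, at
distance at least `r`, when at most `Γ` instances are indicated. At distances about `D * 2⁻ᵏ` there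
are at most `O(2 ^ (d * k))` such times, by packing in the whole space, and `O(1)` per indicated
instance, by packing in the ball around it. -/
lemma IsDoubling.card_far_influence_le {S : Type*} [PseudoMetricSpace S] {d : ℝ}
    (hd : IsDoubling S d) (hd0 : 0 < d) {D : ℝ} (hD0 : 0 < D) (hD : ∀ a b : S, dist a b ≤ D)
    (x xt : ℕ → S) (I : ℕ → Bool)
    (hnn : ∀ n, 1 ≤ n → ∀ m < n, dist (x n) (xt n) ≤ dist (x n) (x m))
    (N : ℕ) {Γ r : ℝ} (hr : 0 < r) (hΓ : 0 < Γ)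
    (hI : ((∑ m ∈ Finset.range (N + 1), (I m).toNat : ℕ) : ℝ) ≤ Γ)
    (i : ℕ) (hi : (D / r) ^ d ≤ Γ * ((2 : ℝ) ^ d) ^ i) :
    (((Finset.Icc 1 N).filter fun n =>
        (∃ m < n, I m = true ∧ x m = xt n) ∧ r ≤ dist (x n) (xt n)).card : ℝ) ≤
      ((2 : ℝ) ^ d) ^ 4 * (Γ * (i + (2 : ℝ) ^ d / ((2 : ℝ) ^ d - 1))) := by
  set a : ℝ := (2 : ℝ) ^ d with ha
  have ha1 : 1 < a := Real.one_lt_rpow (by norm_num) hd0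
  set F := (Finset.Icc 1 N).filter fun n =>
        (∃ m < n, I m = true ∧ x m = xt n) ∧ r ≤ dist (x n) (xt n) with hF
  have hbound : 0 ≤ a ^ 4 * (Γ * (i + a / (a - 1))) := by
    have : 0 < a / (a - 1) := div_pos (by linarith) (by linarith)
    positivity
  have hscale : ∀ n ∈ F, ∃ k : ℕ, (1 / 2 : ℝ) ^ (k + 1) < dist (x n) (xt n) / D ∧
      dist (x n) (xt n) / D ≤ (1 / 2 : ℝ) ^ k := by
    intro n hn
    have h := (Finset.mem_filter.1 hn).2.2
    exact exists_nat_pow_near_of_lt_one (div_pos (hr.trans_le h) hD0)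
      ((div_le_one hD0).2 (hD _ _)) (by norm_num) (by norm_num)
  choose! k hk1 hk2 using hscale
  rcases F.eq_empty_or_nonempty with hFe | hFne
  · rw [hFe]; simpa using hbound
  have hsep : ∀ j, ∀ n ∈ F, ∀ m ∈ F, k n = j → k m = j → n ≠ m →
      (1 / 2) ^ (j + 1) * D ≤ dist (x n) (x m) := by
    have key : ∀ n ∈ F, ∀ m < n, (1 / 2) ^ (k n + 1) * D ≤ dist (x n) (x m) := by
      intro n hn m hm
      have h1 := (lt_div_iff₀ hD0).1 (hk1 n hn)
      have h2 := hnn n (Finset.mem_Icc.1 (Finset.mem_filter.1 hn).1).1 m hm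
      linarith
    intro j n hn m hm hnj hmj hne
    rcases lt_or_gt_of_ne hne with h | h
    · rw [dist_comm, ← hmj]; exact key m hm n h
    · rw [← hnj]; exact key n hn m h
  have hcard : ∀ j, ((F.filter fun n => k n = j).card : ℝ) ≤ a ^ 4 * min (a ^ j) Γ := by
    intro j
    rw [mul_min_of_nonneg _ _ (by positivity)]
    refine le_min ?_ ?_
    · obtain ⟨n₀, -⟩ := hFne
      rw [← pow_add, add_comm]
      refine hd.card_le_of_separated _ x (x n₀) (R := 2 * D) (by positivity) _ ?_ ?_
      · intro n _
        exact (hD _ _).trans_lt (by linarith)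
      · intro n hn m hm hne
        rw [Finset.mem_filter] at hn hm
        refine le_trans (le_of_eq ?_) (hsep j n hn.1 m hm.1 hn.2 hm.2 hne)
        ring
    · set J := (Finset.range (N + 1)).filter fun m => I m = true with hJ
      have hJcard : (J.card : ℝ) ≤ Γ := by
        refine le_trans (le_of_eq ?_) hI
        rw [hJ, Finset.card_filter]
        congr 1
        refine Finset.sum_congr rfl fun m _ => ?_
        cases I m <;> rfl
      have hsub : (F.filter fun n => k n = j) ⊆
          J.biUnion fun m => F.filter fun n => k n = j ∧ xt n = x m := by
        intro n hn
        rw [Finset.mem_filter] at hn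
        obtain ⟨hnI, ⟨m, hmn, hIm, hxm⟩, -⟩ := Finset.mem_filter.1 hn.1
        have := (Finset.mem_Icc.1 hnI).2
        exact Finset.mem_biUnion.2 ⟨m, Finset.mem_filter.2 ⟨Finset.mem_range.2 (by omega), hIm⟩,
          Finset.mem_filter.2 ⟨hn.1, hn.2, hxm.symm⟩⟩
      calc ((F.filter fun n => k n = j).card : ℝ)
          ≤ ∑ m ∈ J, ((F.filter fun n => k n = j ∧ xt n = x m).card : ℝ) := by
            exact_mod_cast (Finset.card_le_card hsub).trans Finset.card_biUnion_le
        _ ≤ ∑ _m ∈ J, a ^ 4 := by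
            refine Finset.sum_le_sum fun m _ => ?_
            refine hd.card_le_of_separated _ x (x m) (R := 2 * ((1 / 2) ^ j * D))
              (by positivity) _ ?_ ?_
            · intro n hn
              obtain ⟨hnF, hnj, hnm⟩ := Finset.mem_filter.1 hn
              have h := (div_le_iff₀ hD0).1 (hk2 n hnF)
              rw [hnj, hnm] at h
              have : 0 < (1 / 2) ^ j * D := by positivity
              exact h.trans_lt (by linarith)
            · intro n hn n' hn' hne
              rw [Finset.mem_filter] at hn hn'
              refine le_trans (le_of_eq ?_)
                (hsep j n hn.1 n' hn'.1 hn.2.1 hn'.2.1 hne)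
              ring
        _ = J.card * a ^ 4 := by simp
        _ ≤ a ^ 4 * Γ := by rw [mul_comm]; gcongr
  obtain ⟨n₁, hn₁, hK⟩ := Finset.exists_mem_eq_sup F hFne k
  set K := F.sup k
  have haK : a ^ K ≤ Γ * a ^ i := by
    refine le_trans ?_ hi
    have h1 := (Finset.mem_filter.1 hn₁).2.2
    have h2 := (div_le_iff₀ hD0).1 (hk2 n₁ hn₁)
    have h3 : (2 : ℝ) ^ K ≤ D / r := by
      rw [le_div_iff₀ hr]
      rw [← hK, one_div, inv_pow] at h2
      have h4 : r ≤ ((2 : ℝ) ^ K)⁻¹ * D := h1.trans h2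
      rwa [inv_mul_eq_div, le_div_iff₀ (by positivity), mul_comm] at h4
    calc a ^ K = ((2 : ℝ) ^ K) ^ d := by
          rw [ha, ← Real.rpow_natCast, ← Real.rpow_mul (by norm_num), mul_comm,
            Real.rpow_mul (by norm_num), Real.rpow_natCast]
      _ ≤ (D / r) ^ d := Real.rpow_le_rpow (by positivity) h3 hd0.le
  calc (F.card : ℝ) = ∑ j ∈ Finset.range (K + 1), ((F.filter fun n => k n = j).card : ℝ) := by
        exact_mod_cast Finset.card_eq_sum_card_fiberwise
          fun n hn => by simpa [Nat.lt_succ_iff] using Finset.le_sup (f := k) hn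
    _ ≤ ∑ j ∈ Finset.range (K + 1), a ^ 4 * min (a ^ j) Γ := Finset.sum_le_sum fun j _ => hcard j
    _ = a ^ 4 * ∑ j ∈ Finset.range (K + 1), min (a ^ j) Γ := by rw [Finset.mul_sum]
    _ ≤ _ := by gcongr; exact sum_min_pow_le ha1 hΓ i K haK

/-! ### Random sets determined by the past -/

/-- A bound on the conditional probability of `Y ∈ A i`, for each of countably many fixed sets
`A i`, carries over to the random set `A Z` when `Z` is measurable with respect to the conditioning
σ-algebra `m`. It is stated in integrated form, on the events `G` of `m`. -/
lemma measure_inter_mem_le {Ω S ι : Type*} {m mΩ : MeasurableSpace Ω} [MeasurableSpace S]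
    [MeasurableSpace ι] [Countable ι] [MeasurableSingletonClass ι]
    {P : Measure Ω} [IsProbabilityMeasure P] (hm : m ≤ mΩ) {Z : Ω → ι} (hZ : Measurable[m] Z)
    {Y : Ω → S} (hY : Measurable Y) {A : ι → Set S} (hA : ∀ i, MeasurableSet (A i))
    {p : ℝ} (hp : ∀ i, ∀ᵐ ω ∂P, (P⟦Y ⁻¹' A i | m⟧) ω ≤ p)
    {G : Set Ω} (hG : MeasurableSet[m] G) :
    P (G ∩ {ω | Y ω ∈ A (Z ω)}) ≤ ENNReal.ofReal p * P G := by
  have hH : ∀ i, MeasurableSet[m] (G ∩ Z ⁻¹' {i}) :=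
    fun i => hG.inter (hZ (measurableSet_singleton i))
  have hone : ∀ i, P (G ∩ Z ⁻¹' {i} ∩ Y ⁻¹' A i) ≤ ENNReal.ofReal p * P (G ∩ Z ⁻¹' {i}) := by
    intro i
    have hE : MeasurableSet (Y ⁻¹' A i) := hY (hA i)
    have hint : Integrable ((Y ⁻¹' A i).indicator fun _ => (1 : ℝ)) P :=
      (integrable_const 1).indicator hE
    have h1 : P.real (G ∩ Z ⁻¹' {i} ∩ Y ⁻¹' A i) ≤ p * P.real (G ∩ Z ⁻¹' {i}) := by
      calc P.real (G ∩ Z ⁻¹' {i} ∩ Y ⁻¹' A i)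
          = ∫ ω in G ∩ Z ⁻¹' {i}, (Y ⁻¹' A i).indicator (fun _ => (1 : ℝ)) ω ∂P := by
            rw [setIntegral_indicator hE]; simp
        _ = ∫ ω in G ∩ Z ⁻¹' {i}, (P⟦Y ⁻¹' A i | m⟧) ω ∂P :=
            (setIntegral_condExp hm hint (hH i)).symm
        _ ≤ ∫ _ω in G ∩ Z ⁻¹' {i}, p ∂P :=
            setIntegral_mono_ae integrable_condExp.integrableOn (integrable_const p).integrableOn
              (hp i)
        _ = p * P.real (G ∩ Z ⁻¹' {i}) := by simp [mul_comm]
    calc P (G ∩ Z ⁻¹' {i} ∩ Y ⁻¹' A i) = ENNReal.ofReal (P.real (G ∩ Z ⁻¹' {i} ∩ Y ⁻¹' A i)) := by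
          simp
      _ ≤ ENNReal.ofReal (p * P.real (G ∩ Z ⁻¹' {i})) := ENNReal.ofReal_le_ofReal h1
      _ = _ := by rw [ENNReal.ofReal_mul' measureReal_nonneg]; simp
  calc P (G ∩ {ω | Y ω ∈ A (Z ω)}) ≤ P (⋃ i, G ∩ Z ⁻¹' {i} ∩ Y ⁻¹' A i) := by
        refine measure_mono fun ω hω => Set.mem_iUnion.2 ⟨Z ω, ⟨hω.1, rfl⟩, hω.2⟩
    _ ≤ ∑' i, P (G ∩ Z ⁻¹' {i} ∩ Y ⁻¹' A i) := measure_iUnion_le _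
    _ ≤ ∑' i, ENNReal.ofReal p * P (G ∩ Z ⁻¹' {i}) := ENNReal.tsum_le_tsum hone
    _ = ENNReal.ofReal p * P (⋃ i, G ∩ Z ⁻¹' {i}) := by
        rw [ENNReal.tsum_mul_left, measure_iUnion _ fun i => hm _ (hH i)]
        intro i j hij
        refine Set.disjoint_left.2 fun ω h1 h2 => hij ?_
        exact h1.2.symm.trans h2.2
    _ ≤ ENNReal.ofReal p * P G := by gcongr; simp

/-! ### Frequency of conditionally rare events -/

/-- If `E n` has conditional probability at most `p` given `F n`, then the exponential moments of
the number of the first `N` events that occur are at most those of a binomial variable. -/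
lemma lintegral_prod_le {Ω : Type*} {mΩ : MeasurableSpace Ω} {P : Measure Ω}
    [IsProbabilityMeasure P] {F : ℕ → MeasurableSpace Ω} (hmono : Monotone F)
    (hle : ∀ n, F n ≤ mΩ) {E : ℕ → Set Ω} (hE : ∀ n, MeasurableSet[F (n + 1)] (E n)) {p : ℝ≥0∞}
    (hp : ∀ n G, MeasurableSet[F n] G → P (G ∩ E n) ≤ p * P G) (a : ℝ≥0∞) (N : ℕ) :
    ∫⁻ ω, ∏ n ∈ Finset.range N, (1 + (E n).indicator (fun _ => a) ω) ∂P ≤ (1 + a * p) ^ N := by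
  induction N with
  | zero => simp
  | succ N ih =>
    set f : Ω → ℝ≥0∞ := fun ω => ∏ n ∈ Finset.range N, (1 + (E n).indicator (fun _ => a) ω) with hf
    have hfm : Measurable[F N] f := by
      refine Finset.measurable_fun_prod _ fun n hn => Measurable.const_add ?_ 1
      exact measurable_const.indicator (hmono (Finset.mem_range.1 hn) _ (hE n))
    have hfm' : Measurable f := hfm.mono (hle N) le_rfl
    have hEN : MeasurableSet (E N) := hle _ _ (hE N)
    have hkey : ∫⁻ ω in E N, f ω ∂P ≤ p * ∫⁻ ω, f ω ∂P := by
      rw [← lintegral_trim (hle N) hfm, ← lintegral_trim (hle N) hfm, ← smul_eq_mul,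
        ← lintegral_smul_measure]
      refine lintegral_mono' (Measure.le_iff.2 fun G hG => ?_) le_rfl
      rw [trim_measurableSet_eq (hle N) hG, Measure.restrict_apply (hle N _ hG),
        Measure.smul_apply, trim_measurableSet_eq (hle N) hG]
      exact hp N G hG
    calc ∫⁻ ω, ∏ n ∈ Finset.range (N + 1), (1 + (E n).indicator (fun _ => a) ω) ∂P
        = ∫⁻ ω, f ω + a * (E N).indicator f ω ∂P := by
          refine lintegral_congr fun ω => ?_
          rw [Finset.prod_range_succ, mul_add, mul_one]
          by_cases h : ω ∈ E N <;> simp [h, hf, mul_comm]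
      _ = ∫⁻ ω, f ω ∂P + a * ∫⁻ ω in E N, f ω ∂P := by
          rw [lintegral_add_left hfm', lintegral_const_mul _ (hfm'.indicator hEN),
            lintegral_indicator hEN]
      _ ≤ ∫⁻ ω, f ω ∂P + a * (p * ∫⁻ ω, f ω ∂P) := by gcongr
      _ = (∫⁻ ω, f ω ∂P) * (1 + a * p) := by ring
      _ ≤ (1 + a * p) ^ N * (1 + a * p) := by gcongr
      _ = _ := (pow_succ _ _).symm

/-- If `E n` has conditional probability at most `p` given `F n`, then almost surely the asymptotic
frequency of the events that occur is at most `p`: by Chernoff's bound, frequencies above `b > p`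
have exponentially small probability, and the Borel-Cantelli lemma applies. -/
lemma ae_eventually_sum_indicator_le {Ω : Type*} {mΩ : MeasurableSpace Ω} {P : Measure Ω}
    [IsProbabilityMeasure P] {F : ℕ → MeasurableSpace Ω} (hmono : Monotone F)
    (hle : ∀ n, F n ≤ mΩ) {E : ℕ → Set Ω} (hE : ∀ n, MeasurableSet[F (n + 1)] (E n))
    {p b : ℝ} (hp0 : 0 ≤ p) (hpb : p < b)
    (hp : ∀ n G, MeasurableSet[F n] G → P (G ∩ E n) ≤ ENNReal.ofReal p * P G) :
    ∀ᵐ ω ∂P, ∀ᶠ N : ℕ in atTop,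
      ∑ n ∈ Finset.range N, (E n).indicator (fun _ => (1 : ℝ)) ω ≤ b * N := by
  set a : ℝ := (b - p) / (p + 1) with ha
  have ha0 : 0 < a := div_pos (by linarith) (by linarith)
  -- The slopes at `a = 0` of `(1 + a) ^ b` and `1 + a * p` are `b` and `p`.
  have hlog : Real.log (1 + a * p) < Real.log (1 + a) * b := by
    have h1 : Real.log (1 + a * p) ≤ a * p := by
      have := Real.log_le_sub_one_of_pos (show 0 < 1 + a * p by positivity)
      linarith
    have h2 : a / (1 + a) ≤ Real.log (1 + a) := by
      have := Real.one_sub_inv_le_log_of_pos (show 0 < 1 + a by positivity)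
      refine le_trans (le_of_eq ?_) this
      field_simp
      ring
    have h3 : a * p < a / (1 + a) * b := by
      have h4 : a * (p + 1) = b - p := div_mul_cancel₀ _ (by linarith)
      rw [div_mul_eq_mul_div a, lt_div_iff₀ (by positivity)]
      nlinarith
    have h5 : a / (1 + a) * b ≤ Real.log (1 + a) * b :=
      mul_le_mul_of_nonneg_right h2 (hp0.trans hpb.le)
    linarith
  set θ : ℝ := (1 + a * p) / (1 + a) ^ b with hθ
  have hq : 0 < (1 + a) ^ b := Real.rpow_pos_of_pos (by positivity) _
  have hθ0 : 0 ≤ θ := by positivity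
  have hθ1 : θ < 1 := by
    rw [hθ, div_lt_one hq, Real.rpow_def_of_pos (by positivity)]
    exact (Real.log_lt_iff_lt_exp (by positivity)).1 hlog
  set W : ℕ → Ω → ℝ := fun N ω => ∑ n ∈ Finset.range N, (E n).indicator (fun _ => (1 : ℝ)) ω with hW
  have hprod : ∀ N ω, ∏ n ∈ Finset.range N,
      (1 + (E n).indicator (fun _ => ENNReal.ofReal a) ω) = ENNReal.ofReal ((1 + a) ^ W N ω) := by
    intro N ω
    rw [hW, Real.rpow_sum_of_pos (by positivity), ENNReal.ofReal_prod_of_nonneg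
      fun n _ => Real.rpow_nonneg (by positivity) _]
    refine Finset.prod_congr rfl fun n _ => ?_
    by_cases h : ω ∈ E n
    · simp [h, ENNReal.ofReal_add zero_le_one ha0.le]
    · simp [h]
  have htail : ∀ N, P {ω | b * N < W N ω} ≤ ENNReal.ofReal (θ ^ N) := by
    intro N
    have hmeas : Measurable fun ω => ENNReal.ofReal ((1 + a) ^ W N ω) := by
      simp_rw [← hprod]
      exact Finset.measurable_fun_prod _ fun n _ =>
        Measurable.const_add (measurable_const.indicator (hle _ _ (hE n))) 1
    have h1 := mul_meas_ge_le_lintegral (μ := P) hmeas (ENNReal.ofReal (((1 + a) ^ b) ^ N))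
    simp_rw [← hprod] at h1
    have h2 := h1.trans (lintegral_prod_le hmono hle hE hp (ENNReal.ofReal a) N)
    simp_rw [hprod] at h2
    have h3 : P {ω | b * N < W N ω} ≤
        P {ω | ENNReal.ofReal (((1 + a) ^ b) ^ N) ≤ ENNReal.ofReal ((1 + a) ^ W N ω)} := by
      refine measure_mono fun ω hω => ENNReal.ofReal_le_ofReal ?_
      rw [← Real.rpow_natCast, ← Real.rpow_mul (by positivity)]
      exact Real.rpow_le_rpow_of_exponent_le (by linarith) (le_of_lt hω)
    have h4 : (1 + ENNReal.ofReal a * ENNReal.ofReal p) ^ N = ENNReal.ofReal ((1 + a * p) ^ N) := by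
      rw [← ENNReal.ofReal_mul ha0.le, ← ENNReal.ofReal_one, ← ENNReal.ofReal_add zero_le_one
        (by positivity), ENNReal.ofReal_pow (by positivity)]
    rw [h4] at h2
    rw [hθ, div_pow, ENNReal.ofReal_div_of_pos (by positivity)]
    refine h3.trans ((ENNReal.le_div_iff_mul_le (Or.inl ?_) (Or.inl ENNReal.ofReal_ne_top)).2 ?_)
    · exact (ENNReal.ofReal_pos.2 (by positivity)).ne'
    · rwa [mul_comm]
  have hsum : ∑' N, P {ω | b * N < W N ω} ≠ ∞ := by
    refine ne_top_of_le_ne_top ?_ (ENNReal.tsum_le_tsum htail)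
    rw [← ENNReal.ofReal_tsum_of_nonneg (fun N => by positivity)
      (summable_geometric_of_lt_one hθ0 hθ1)]
    exact ENNReal.ofReal_ne_top
  filter_upwards [ae_eventually_notMem hsum] with ω hω
  filter_upwards [hω] with N hN
  exact not_lt.1 hN

/-! ### Influence at small distance -/

lemma past_mono {Ω S : Type*} [MeasurableSpace S] (X : ℕ → Ω → S) : Monotone (past X) :=
  fun _ _ h => iSup₂_le fun m hm => le_iSup₂_of_le m (hm.trans_le h) le_rfl

lemma past_le {Ω S : Type*} [mΩ : MeasurableSpace Ω] [MeasurableSpace S] {X : ℕ → Ω → S}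
    (hX : ∀ n, Measurable (X n)) (n : ℕ) : past X n ≤ mΩ :=
  iSup₂_le fun m _ => (hX m).comap_le

lemma measurable_past {Ω S : Type*} [MeasurableSpace S] (X : ℕ → Ω → S) {m n : ℕ} (h : m < n) :
    Measurable[past X n] (X m) :=
  Measurable.of_comap_le (le_iSup₂_of_le m h le_rfl)

lemma UniformlyDominated.ae_condExp_lt {Ω S : Type*} [MeasurableSpace Ω] [MeasurableSpace S]
    {P : Measure Ω} [IsProbabilityMeasure P] {ν : Measure S} {X : ℕ → Ω → S} {ε : ℝ → ℝ}
    (h : UniformlyDominated P ν X ε) (hX : ∀ n, Measurable (X n)) {δ : ℝ} (hδ : 0 < δ)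
    {A : Set S} (hA : MeasurableSet A) (hνA : ν A < ENNReal.ofReal δ) (n : ℕ) :
    ∀ᵐ ω ∂P, (P⟦X n ⁻¹' A | past X n⟧) ω < ε δ := by
  have hle : ∀ᵐ ω ∂P, ∀ n, (P⟦X n ⁻¹' A | past X n⟧) ω ≤ 1 := by
    refine ae_all_iff.2 fun n => ?_
    have h1 := condExp_mono (m := past X n) (μ := P)
      ((integrable_const (1 : ℝ)).indicator (hX n hA)) (integrable_const (1 : ℝ))
      (ae_of_all _ fun ω => Set.indicator_le_self' (fun _ _ => zero_le_one) ω)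
    rwa [condExp_const (past_le hX n)] at h1
  -- Boundedness matters: the real supremum of an unbounded family would be `0`.
  filter_upwards [h.2 δ hδ A hA hνA, hle] with ω h1 h2
  exact (le_ciSup (f := fun n => (P⟦X n ⁻¹' A | past X n⟧) ω)
    ⟨1, Set.forall_mem_range.2 h2⟩ n).trans_lt h1

lemma UniformlyDominated.rate_pos {Ω S : Type*} [MeasurableSpace Ω] [MeasurableSpace S]
    {P : Measure Ω} [IsProbabilityMeasure P] {ν : Measure S} {X : ℕ → Ω → S} {ε : ℝ → ℝ}
    (h : UniformlyDominated P ν X ε) (hX : ∀ n, Measurable (X n)) {δ : ℝ} (hδ : 0 < δ) :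
    0 < ε δ := by
  have h1 := h.ae_condExp_lt hX hδ MeasurableSet.empty (by simpa using hδ) 0
  simp only [Set.preimage_empty, Set.indicator_empty] at h1
  rw [show (fun _ : Ω => (0 : ℝ)) = 0 from rfl, condExp_zero] at h1
  exact h1.exists.choose_spec

lemma UniformlyDominated.one_lt_rate {Ω S : Type*} [MeasurableSpace Ω] [MeasurableSpace S]
    {P : Measure Ω} [IsProbabilityMeasure P] {ν : Measure S} {X : ℕ → Ω → S} {ε : ℝ → ℝ}
    (h : UniformlyDominated P ν X ε) (hX : ∀ n, Measurable (X n)) {δ : ℝ} (hδ : 0 < δ)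
    (hν : ν Set.univ < ENNReal.ofReal δ) : 1 < ε δ := by
  have h1 := h.ae_condExp_lt hX hδ MeasurableSet.univ hν 0
  simp only [Set.preimage_univ, Set.indicator_univ] at h1
  rw [condExp_const (past_le hX 0)] at h1
  exact h1.exists.choose_spec

/-- The frequency of the times `n` at which `X n` falls within distance `r n` of an earlier
indicated instance, while at most `γ * (n + 1)` instances have been indicated, is asymptotically at
most `ε δ`, provided that this many balls of radius `2 * r n` have total mass less than `δ`.

The domination hypothesis only concerns fixed sets, so the indicated instances are first moved to
nearby points of a countable dense set: the union of the balls around these points contains the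
relevant neighborhood, is determined by the past, and takes countably many values. -/
lemma ae_eventually_sum_near_le {Ω S : Type*} [mΩ : MeasurableSpace Ω] [PseudoMetricSpace S]
    [TopologicalSpace.SeparableSpace S] [Nonempty S] [MeasurableSpace S] [OpensMeasurableSpace S]
    {P : Measure Ω} [IsProbabilityMeasure P] {ν : Measure S} {X : ℕ → Ω → S} {I : ℕ → Ω → Bool}
    {ε : ℝ → ℝ} (hX : ∀ n, Measurable (X n)) (hdom : UniformlyDominated P ν X ε)
    (hI : IsAdaptedTo I X) {c d γ δ b : ℝ} (hc : 0 < c)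
    (hν : ∀ (x : S) (r : ℝ), 0 < r → ν (Metric.ball x r) ≤ ENNReal.ofReal (c * r ^ d))
    (hδ : 0 < δ) (hb : ε δ < b) {r : ℕ → ℝ} (hr : ∀ n, 0 < r n)
    (hrδ : ∀ n : ℕ, γ * (n + 1) * (c * (2 * r n) ^ d) < δ) :
    ∀ᵐ ω ∂P, ∀ᶠ N : ℕ in atTop, ∑ n ∈ Finset.range N,
      {n : ℕ | (counter I n ω : ℝ) ≤ γ * (n + 1) ∧
        ∃ m < n, I m ω = true ∧ dist (X n ω) (X m ω) < r n}.indicator (fun _ => (1 : ℝ)) n ≤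
      b * N := by
  classical
  set s := TopologicalSpace.denseSeq S
  have hs : ∀ (n : ℕ) (x : S), ∃ j, dist x (s j) < r n := fun n x =>
    (TopologicalSpace.denseRange_denseSeq S).exists_dist_lt x (hr n)
  -- `T n x` is the index of a point of the dense sequence within distance `r n` of `x`.
  set T : ℕ → S → ℕ := fun n x => Nat.find (hs n x) with hT
  have hTm : ∀ n, Measurable (T n) := fun n =>
    measurable_find (hs n) fun j => (isOpen_lt (by fun_prop) (by fun_prop)).measurableSet
  set Z : (n : ℕ) → Ω → (Fin n → ℕ × Bool) := fun n ω m => (T n (X m ω), I m ω) with hZ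
  have hZm : ∀ n, Measurable[past X n] (Z n) := by
    intro n
    refine @measurable_pi_lambda _ _ _ (past X n) _ _ fun m => ?_
    exact ((hTm n).comp (measurable_past X m.2)).prodMk
      ((hI m).mono (past_mono X m.2) le_rfl)
  set A : (n : ℕ) → (Fin n → ℕ × Bool) → Set S := fun n z =>
    if ((Finset.univ.filter fun m => (z m).2 = true).card : ℝ) ≤ γ * (n + 1) then
      ⋃ m ∈ Finset.univ.filter fun m => (z m).2 = true, Metric.ball (s (z m).1) (2 * r n)
    else ∅ with hA
  have hAm : ∀ n z, MeasurableSet (A n z) := by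
    intro n z
    simp only [hA]
    split_ifs
    · exact Finset.measurableSet_biUnion _ fun m _ => measurableSet_ball
    · exact MeasurableSet.empty
  have hAν : ∀ n z, ν (A n z) < ENNReal.ofReal δ := by
    intro n z
    simp only [hA]
    split_ifs with hcard
    · have h2r : 0 < 2 * r n := mul_pos two_pos (hr n)
      have hnn : 0 ≤ c * (2 * r n) ^ d := by positivity
      set J := Finset.univ.filter fun m => (z m).2 = true
      calc ν (⋃ m ∈ J, Metric.ball (s (z m).1) (2 * r n))
          ≤ ∑ m ∈ J, ν (Metric.ball (s (z m).1) (2 * r n)) := measure_biUnion_finset_le _ _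
        _ ≤ ∑ _m ∈ J, ENNReal.ofReal (c * (2 * r n) ^ d) :=
            Finset.sum_le_sum fun m _ => hν _ _ h2r
        _ = ENNReal.ofReal (J.card * (c * (2 * r n) ^ d)) := by
            rw [ENNReal.ofReal_mul (Nat.cast_nonneg _)]; simp
        _ < ENNReal.ofReal δ := by
            refine (ENNReal.ofReal_lt_ofReal_iff hδ).2 (lt_of_le_of_lt ?_ (hrδ n))
            exact mul_le_mul_of_nonneg_right hcard hnn
    · simpa using hδ
  have hE : ∀ n, MeasurableSet[past X (n + 1)] {ω | X n ω ∈ A n (Z n ω)} := by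
    intro n
    have h : {ω | X n ω ∈ A n (Z n ω)} = ⋃ z, Z n ⁻¹' {z} ∩ X n ⁻¹' A n z := by
      ext ω; simp
    rw [h]
    exact MeasurableSet.iUnion fun z =>
      (past_mono X n.le_succ _ (hZm n (measurableSet_singleton z))).inter
        (measurable_past X n.lt_succ_self (hAm n z))
  have hfreq := ae_eventually_sum_indicator_le (P := P) (past_mono X) (past_le hX) hE
    (hdom.rate_pos hX hδ).le hb fun n G hG =>
      measure_inter_mem_le (past_le hX n) (hZm n) (hX n) (hAm n)
        (fun z => (hdom.ae_condExp_lt hX hδ (hAm n z) (hAν n z) n).mono fun _ h => h.le) hG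
  filter_upwards [hfreq] with ω hω
  filter_upwards [hω] with N hN
  refine le_trans (Finset.sum_le_sum fun n _ => ?_) hN
  rw [Set.indicator_apply]
  split_ifs with hn
  swap
  · exact Set.indicator_nonneg (fun _ _ => zero_le_one) _
  obtain ⟨hcount, m, hmn, hIm, hdist⟩ := hn
  refine (Set.indicator_of_mem (a := ω) (f := fun _ => (1 : ℝ)) ?_).ge
  have hcard : ((Finset.univ.filter fun m => (Z n ω m).2 = true).card : ℝ) ≤ γ * (n + 1) := by
    refine le_trans ?_ hcount
    rw [counter, Finset.sum_range_succ, Finset.sum_range, Finset.card_filter]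
    refine mod_cast (Finset.sum_le_sum fun k _ => ?_).trans (Nat.le_add_right _ _)
    simp only [hZ]
    cases I k ω <;> simp
  simp only [hA, Set.mem_ofPred_eq, if_pos hcard]
  refine Set.mem_iUnion₂.2 ⟨⟨m, hmn⟩, Finset.mem_filter.2 ⟨Finset.mem_univ _, hIm⟩, ?_⟩
  have h1 : dist (X m ω) (s (T n (X m ω))) < r n := Nat.find_spec (hs n (X m ω))
  have h2 := dist_triangle (X n ω) (X m ω) (s (T n (X m ω)))
  rw [Metric.mem_ball]
  simp only [hZ]
  linarith

/-! ### Deterministic estimates along a trajectory -/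

lemma influenceRate_nonneg {Ω S : Type*} (X Xt : ℕ → Ω → S) (I : ℕ → Ω → Bool) (N : ℕ) (ω : Ω) :
    0 ≤ influenceRate X Xt I N ω :=
  mul_nonneg (by positivity)
    (Finset.sum_nonneg fun _ _ => Set.indicator_nonneg (fun _ _ => zero_le_one) _)

lemma influenceRate_le_one {Ω S : Type*} (X Xt : ℕ → Ω → S) (I : ℕ → Ω → Bool) (N : ℕ) (ω : Ω) :
    influenceRate X Xt I N ω ≤ 1 := by
  have h : ∑ n ∈ Finset.Icc 1 N,
      {n : ℕ | Xt n ω ∈ indicated X I n ω}.indicator (fun _ => (1 : ℝ)) n ≤ N := by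
    refine (Finset.sum_le_sum fun n _ =>
      Set.indicator_le_self' (fun _ _ => zero_le_one) n).trans ?_
    simp
  rw [influenceRate, one_div_mul_eq_div]
  exact div_le_one_of_le₀ h (Nat.cast_nonneg _)

lemma limsup_influenceRate_le {Ω S : Type*} {X Xt : ℕ → Ω → S} {I : ℕ → Ω → Bool} {ω : Ω} {x : ℝ}
    (h : ∀ᶠ N in atTop, influenceRate X Xt I N ω ≤ x) :
    limsup (fun N => influenceRate X Xt I N ω) atTop ≤ x :=
  limsup_le_of_le (isBoundedUnder_of ⟨0, fun N => influenceRate_nonneg X Xt I N ω⟩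
    |>.isCoboundedUnder_le) h

lemma eventually_counter_le {Ω : Type*} {I : ℕ → Ω → Bool} {γ : ℝ} {ω : Ω}
    (h : limsup (fun n : ℕ => (counter I n ω : ℝ) / n) atTop < γ) :
    ∀ᶠ n : ℕ in atTop, (counter I n ω : ℝ) ≤ γ * n := by
  have hbdd : IsBoundedUnder (· ≤ ·) atTop fun n : ℕ => (counter I n ω : ℝ) / n := by
    refine isBoundedUnder_of ⟨2, fun n => ?_⟩
    have h1 : counter I n ω ≤ n + 1 := by
      rw [counter]
      refine (Finset.sum_le_sum (g := fun _ => 1) fun m _ => Bool.toNat_le _).trans ?_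
      simp
    rcases Nat.eq_zero_or_pos n with rfl | hn
    · simp
    · refine div_le_of_le_mul₀ (Nat.cast_nonneg _) zero_le_two ?_
      have : n + 1 ≤ 2 * n := by omega
      exact_mod_cast h1.trans this
  filter_upwards [eventually_lt_of_limsup_lt h hbdd, eventually_gt_atTop 0] with n h1 hn
  exact ((div_lt_iff₀ (by exact_mod_cast hn)).1 h1).le

open Classical in
/-- From time `N₀` on, every influence of an indicated instance occurs either at distance less than
`r n` or at distance at least `r N`. -/
lemma sum_influence_le {Ω S : Type*} [PseudoMetricSpace S] {X Xt : ℕ → Ω → S} {I : ℕ → Ω → Bool}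
    {ω : Ω} {γ : ℝ} (hγ : 0 < γ) {r : ℕ → ℝ} (hr : Antitone r) {N₀ : ℕ}
    (hN₀ : ∀ n ≥ N₀, (counter I n ω : ℝ) ≤ γ * n) (N : ℕ) :
    ∑ n ∈ Finset.Icc 1 N, {n : ℕ | Xt n ω ∈ indicated X I n ω}.indicator (fun _ => (1 : ℝ)) n ≤
      N₀ + (∑ n ∈ Finset.range (N + 1), {n : ℕ | (counter I n ω : ℝ) ≤ γ * (n + 1) ∧
          ∃ m < n, I m ω = true ∧ dist (X n ω) (X m ω) < r n}.indicator (fun _ => (1 : ℝ)) n) +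
        ((Finset.Icc 1 N).filter fun n => (∃ m < n, I m ω = true ∧ X m ω = Xt n ω) ∧
          r N ≤ dist (X n ω) (Xt n ω)).card := by
  set near : Set ℕ := {n : ℕ | (counter I n ω : ℝ) ≤ γ * (n + 1) ∧
    ∃ m < n, I m ω = true ∧ dist (X n ω) (X m ω) < r n} with hnear
  set far : ℕ → Prop := fun n =>
    (∃ m < n, I m ω = true ∧ X m ω = Xt n ω) ∧ r N ≤ dist (X n ω) (Xt n ω) with hfar
  have hnn : ∀ n, 0 ≤ near.indicator (fun _ => (1 : ℝ)) n :=
    fun n => Set.indicator_nonneg (fun _ _ => zero_le_one) n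
  have hearly : ∑ n ∈ Finset.Icc 1 N, (if n < N₀ then (1 : ℝ) else 0) ≤ N₀ := by
    rw [← Finset.sum_filter]
    have h : (Finset.Icc 1 N).filter (· < N₀) ⊆ Finset.range N₀ := fun n hn =>
      Finset.mem_range.2 (Finset.mem_filter.1 hn).2
    simpa using (Finset.card_le_card h)
  have hlate : ∑ n ∈ Finset.Icc 1 N, near.indicator (fun _ => (1 : ℝ)) n ≤
      ∑ n ∈ Finset.range (N + 1), near.indicator (fun _ => (1 : ℝ)) n := by
    refine Finset.sum_le_sum_of_subset_of_nonneg (fun n hn => ?_) fun n _ _ => hnn n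
    have := (Finset.mem_Icc.1 hn).2
    exact Finset.mem_range.2 (by omega)
  have hcard : (((Finset.Icc 1 N).filter far).card : ℝ) =
      ∑ n ∈ Finset.Icc 1 N, if far n then (1 : ℝ) else 0 := by
    rw [Finset.card_filter]; push_cast; rfl
  rw [hcard]
  refine le_trans (Finset.sum_le_sum (g := fun n => (if n < N₀ then (1 : ℝ) else 0) +
    near.indicator (fun _ => (1 : ℝ)) n + if far n then (1 : ℝ) else 0) fun n hn => ?_) ?_
  · have h1 : (0 : ℝ) ≤ if n < N₀ then (1 : ℝ) else 0 := by positivity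
    have h2 : (0 : ℝ) ≤ if far n then (1 : ℝ) else 0 := by positivity
    have h3 := hnn n
    by_cases hinf : Xt n ω ∈ indicated X I n ω
    swap
    · rw [Set.indicator_of_notMem (by exact hinf)]
      positivity
    rw [Set.indicator_of_mem (by exact hinf)]
    by_cases hn0 : n < N₀
    · rw [if_pos hn0]; linarith
    obtain ⟨m, hmn, hIm, hXm⟩ := hinf
    rcases lt_or_ge (dist (X n ω) (Xt n ω)) (r n) with hd | hd
    · have hmem : n ∈ near := by
        refine ⟨(hN₀ n (not_lt.1 hn0)).trans ?_, m, hmn, hIm, hXm ▸ hd⟩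
        nlinarith
      rw [Set.indicator_of_mem hmem]; linarith
    · have hmem : far n := ⟨⟨m, hmn, hIm, hXm⟩, (hr (Finset.mem_Icc.1 hn).2).trans hd⟩
      rw [if_pos hmem]; linarith
  · rw [Finset.sum_add_distrib, Finset.sum_add_distrib]
    gcongr

end NNInfluence

/-! ### The long-term influence bound -/

theorem mainTheorem3 {S : Type u} [MetricSpace S] [TopologicalSpace.SeparableSpace S]
    [BoundedSpace S] [MeasurableSpace S] [BorelSpace S] (ν : Measure S) [IsFiniteMeasure ν]
    (hν : NNInfluence.IsUpperDoubling ν) :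
    ∃ c₁ c₂ : ℝ, 0 < c₁ ∧ 0 < c₂ ∧
      ∀ (Ω : Type v) (mΩ : MeasurableSpace Ω) (P : Measure Ω) (_ : IsProbabilityMeasure P)
        (X Xt : ℕ → Ω → S) (I : ℕ → Ω → Bool) (ε : ℝ → ℝ) (γ : ℝ),
        (∀ n, Measurable (X n)) →
        NNInfluence.UniformlyDominated P ν X ε →
        NNInfluence.IsNearestNeighborProcess X Xt →
        NNInfluence.IsAdaptedTo I X →
        0 < γ → NNInfluence.IsRateLimited P I γ →
        ∀ δ : ℝ, 0 < δ →
          ∀ᵐ ω ∂P, limsup (fun N : ℕ => NNInfluence.influenceRate X Xt I N ω) atTop <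
            γ * max 0 (c₁ + c₂ * Real.log (1 / δ)) + ε δ := by
  classical
  obtain ⟨d, hd0, hdoub, c₀, hc₀, hball⟩ := hν
  obtain ⟨D₀, hD₀⟩ := Metric.isBounded_iff.1 (Bornology.IsBounded.all (Set.univ : Set S))
  set D : ℝ := max D₀ 1 with hDdef
  have hD0 : 0 < D := lt_max_of_lt_right one_pos
  have hD : ∀ x y : S, dist x y ≤ D := fun x y =>
    (hD₀ (Set.mem_univ x) (Set.mem_univ y)).trans (le_max_left _ _)
  set V : ℝ := (ν Set.univ).toReal
  set a : ℝ := (2 : ℝ) ^ d with ha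
  have ha1 : 1 < a := Real.one_lt_rpow (by norm_num) hd0
  have ha0 : 0 < a := by linarith
  have hloga : 0 < Real.log a := Real.log_pos ha1
  have haa : 0 < a / (a - 1) := div_pos ha0 (by linarith)
  -- The constant `c` is enlarged so that `B₀ / δ ≥ 1` for `δ ≤ V`; this makes the logarithm below
  -- nonnegative, and `B₀ ≥ 1` makes `c₁` positive.
  set Q : ℝ := D ^ d * (2 * a) with hQ
  have hDd : 0 < D ^ d := Real.rpow_pos_of_pos hD0 d
  have hQ0 : 0 < Q := by positivity
  set c : ℝ := max c₀ (max V 1 / Q) with hc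
  have hc0 : 0 < c := lt_max_of_lt_left hc₀
  set B₀ : ℝ := Q * c with hB₀
  have hB₀max : max V 1 ≤ B₀ := by
    have := (div_le_iff₀' hQ0).1 (le_max_right c₀ (max V 1 / Q))
    exact this
  have hB₀1 : 1 ≤ B₀ := (le_max_right _ _).trans hB₀max
  have hB₀V : V ≤ B₀ := (le_max_left _ _).trans hB₀max
  have hball' : ∀ (x : S) (r : ℝ), 0 < r →
      ν (Metric.ball x r) ≤ ENNReal.ofReal (c * r ^ d) := fun x r hr =>
    (hball x r hr).trans (ENNReal.ofReal_le_ofReal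
      (mul_le_mul_of_nonneg_right (le_max_left _ _) (by positivity)))
  -- The summand `1` leaves room for the strict inequality.
  refine ⟨a ^ 4 * (Real.log B₀ / Real.log a + 1 + a / (a - 1)) + 1, a ^ 4 / Real.log a, ?_,
    by positivity, ?_⟩
  · have := div_nonneg (Real.log_nonneg hB₀1) hloga.le
    positivity
  intro Ω mΩ P hP X Xt I ε γ hX hdom hNN hI hγ hrate δ hδ
  set M : ℝ := a ^ 4 * (Real.log B₀ / Real.log a + 1 + a / (a - 1)) + 1 +
    a ^ 4 / Real.log a * Real.log (1 / δ) with hM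
  rcases lt_or_ge V δ with hVδ | hδV
  · -- The whole space has mass less than `δ`, so that `ε δ > 1`.
    have hε := hdom.one_lt_rate hX hδ
      ((ENNReal.lt_ofReal_iff_toReal_lt (measure_ne_top ν _)).2 hVδ)
    refine ae_of_all _ fun ω => ?_
    have h1 := NNInfluence.limsup_influenceRate_le
      (Eventually.of_forall fun N => NNInfluence.influenceRate_le_one X Xt I N ω)
    have h2 : 0 ≤ γ * max 0 M := mul_nonneg hγ.le (le_max_left _ _)
    linarith
  have : Nonempty S := (nonempty_of_isProbabilityMeasure P).map (X 0)
  have hB1 : 1 ≤ B₀ / δ := (one_le_div hδ).2 (hδV.trans hB₀V)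
  set i : ℕ := ⌈Real.log (B₀ / δ) / Real.log a⌉₊ with hi
  have hai : B₀ / δ ≤ a ^ i := by
    have h := (div_le_iff₀ hloga).1 (Nat.le_ceil (Real.log (B₀ / δ) / Real.log a))
    rw [← Real.log_pow] at h
    exact (Real.log_le_log_iff (by positivity) (by positivity)).1 h
  have hiM : a ^ 4 * (i + a / (a - 1)) ≤ M - 1 := by
    have h1 : (i : ℝ) ≤ Real.log (B₀ / δ) / Real.log a + 1 :=
      (Nat.ceil_lt_add_one (div_nonneg (Real.log_nonneg hB1) hloga.le)).le
    have h2 : Real.log (B₀ / δ) = Real.log B₀ + Real.log (1 / δ) := by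
      rw [← Real.log_mul (by positivity) (by positivity), mul_one_div]
    calc a ^ 4 * (i + a / (a - 1))
        ≤ a ^ 4 * (Real.log (B₀ / δ) / Real.log a + 1 + a / (a - 1)) := by gcongr
      _ = M - 1 := by rw [h2, hM]; ring
  have hM0 : 0 < M := by
    have : 0 ≤ a ^ 4 * (i + a / (a - 1)) := by positivity
    linarith
  rw [max_eq_right hM0.le]
  -- The radius `r n` gives `γ * (n + 1)` balls of radius `2 * r n` a total mass of `δ / 2`.
  set r : ℕ → ℝ := fun n => (δ / (2 * a * c * γ * (n + 1))) ^ (1 / d) with hr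
  have hrpos : ∀ n, 0 < r n := fun n => Real.rpow_pos_of_pos (by positivity) _
  have hrd : ∀ n, r n ^ d = δ / (2 * a * c * γ * (n + 1)) := fun n => by
    rw [hr, ← Real.rpow_mul (by positivity), one_div_mul_cancel hd0.ne', Real.rpow_one]
  have hranti : Antitone r := fun n m hnm => by
    refine Real.rpow_le_rpow (by positivity) ?_ (by positivity)
    gcongr
  have hrδ : ∀ n : ℕ, γ * (n + 1) * (c * (2 * r n) ^ d) < δ := fun n => by
    have h : γ * (n + 1) * (c * (2 * r n) ^ d) = δ / 2 := by
      rw [Real.mul_rpow zero_le_two (hrpos n).le, hrd, ← ha]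
      field_simp
    rw [h]; linarith
  have hnear := NNInfluence.ae_eventually_sum_near_le hX hdom hI (b := ε δ + γ / 4) hc0 hball' hδ
    (by linarith) hrpos hrδ
  filter_upwards [hrate, hnear] with ω hω hωnear
  obtain ⟨N₀, hN₀⟩ := eventually_atTop.1 (NNInfluence.eventually_counter_le hω)
  set C : ℝ := ε δ + γ / 4 + γ * (M - 1)
  have hsum : ∀ᶠ N : ℕ in atTop, ∑ n ∈ Finset.Icc 1 N,
      {n : ℕ | Xt n ω ∈ NNInfluence.indicated X I n ω}.indicator (fun _ => (1 : ℝ)) n ≤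
        N₀ + C * (N + 1) := by
    filter_upwards [(tendsto_add_atTop_nat 1).eventually hωnear, eventually_ge_atTop N₀]
      with N hN1 hN2
    have hΓ : 0 < γ * ((N : ℝ) + 1) := by positivity
    have hfar := hdoub.card_far_influence_le hd0 hD0 hD (fun n => X n ω) (fun n => Xt n ω)
      (fun n => I n ω) (fun n hn => (hNN n hn ω).2) N (hrpos N) hΓ
      ((hN₀ N hN2).trans (by nlinarith)) i (by
        rw [Real.div_rpow hD0.le (hrpos N).le, hrd]
        refine le_trans (le_of_eq ?_) (mul_le_mul_of_nonneg_left hai hΓ.le)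
        rw [hB₀, hQ]
        field_simp)
    have hfar' : a ^ 4 * (γ * ((N : ℝ) + 1) * (i + a / (a - 1))) ≤
        γ * (M - 1) * (N + 1) := by
      have := mul_le_mul_of_nonneg_left hiM hΓ.le
      linarith
    have hall := NNInfluence.sum_influence_le (Xt := Xt) (X := X) hγ hranti hN₀ N
    push_cast at hN1
    have hC : C * ((N : ℝ) + 1) = (ε δ + γ / 4) * (N + 1) + γ * (M - 1) * (N + 1) := by ring
    rw [hC]
    linarith
  have hsmall : ∀ᶠ N : ℕ in atTop, (N₀ + C) / (N : ℝ) ≤ γ / 4 :=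
    (tendsto_const_div_atTop_nhds_zero_nat (N₀ + C)).eventually_le_const (by positivity)
  refine (NNInfluence.limsup_influenceRate_le (x := C + γ / 4) ?_).trans_lt ?_
  · filter_upwards [hsum, hsmall, eventually_gt_atTop 0] with N h1 h2 hN
    have hN' : (0 : ℝ) < N := by exact_mod_cast hN
    rw [NNInfluence.influenceRate, one_div_mul_eq_div]
    calc _ ≤ (N₀ + C * (N + 1)) / (N : ℝ) := by gcongr
      _ = C + (N₀ + C) / N := by field_simp; ring
      _ ≤ C + γ / 4 := by gcongr
  · have : C + γ / 4 = γ * M + ε δ - γ / 2 := by ring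
    linarith
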